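/- Let $n\ge 1$ be an integer and $0<s<n$. Put $\gamma_s=2^{-s}\pi^{-n/2}\,\Gamma\!\left(\frac{n-s}{2}\right)/\Gamma\!\left(\frac{s}{2}\right)$, let $v_n$ be the volume of the unit ball of $\mathbb{R}^n$, and for $f\in L^1(\mathbb{R}^n)$ let $$I_sf(x)=\gamma_s\int_{\mathbb{R}^n}\frac{f(x-y)}{|y|^{n-s}}\,dy .$$ For a measurable function $g$ on $\mathbb{R}^n$ write $\|g\|_{L^{\frac{n}{n-s},\infty}}=\sup_{\lambda>0}\lambda\,\big|\{x\in\mathbb{R}^n:|g(x)|>\lambda\}\big|^{\frac{n-s}{n}}\in[0,\infty]$. (i) Let $f\in L^1(\mathbb{R}^n)$ be real-valued with $f\ge 0$ almost everywhere (in particular, $f$ may be any positive function in $L^1(\mathbb{R}^n)$). Then the integral defining $I_sf(x)$ converges absolutely for almost every $x$, and $$\|I_sf\|_{L^{\frac{n}{n-s},\infty}}\ \ge\ \gamma_s\,v_n^{\frac{n-s}{n}}\,\|f\|_{L^1(\mathbb{R}^n)} .$$ (ii) The constant is sharp: for all $a,b>0$ and $x_0\in\mathbb{R}^n$, the positive function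 $f(x)=\left(\frac{a}{b+|x-x_0|^2}\right)^{\frac{n+s}{2}}$ belongs to $L^1(\mathbb{R}^n)$ and satisfies $$\|I_sf\|_{L^{\frac{n}{n-s},\infty}}\ =\ \gamma_s\,v_n^{\frac{n-s}{n}}\,\|f\|_{L^1(\mathbb{R}^n)} .$$ -/

import Mathlib

open MeasureTheory

noncomputable section

/-- Euclidean space `ℝⁿ`, with its Euclidean norm and Lebesgue measure. -/
abbrev Euc (n : ℕ) : Type := EuclideanSpace ℝ (Fin n)

/-- The normalizing constant `γ_s = 2^{-s} π^{-n/2} Γ((n-s)/2) / Γ(s/2)`. -/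
def rieszConst (n : ℕ) (s : ℝ) : ℝ :=
  (2 : ℝ) ^ (-s) * Real.pi ^ (-(n : ℝ) / 2) *
    (Real.Gamma (((n : ℝ) - s) / 2) / Real.Gamma (s / 2))

/-- The integrand `y ↦ f (x - y) / |y|^{n-s}` of the Riesz potential at the point `x`. -/
def rieszIntegrand {n : ℕ} (s : ℝ) (f : Euc n → ℝ) (x y : Euc n) : ℝ :=
  f (x - y) / ‖y‖ ^ ((n : ℝ) - s)

/-- The Riesz potential `I_s f (x) = γ_s ∫ f (x - y) / |y|^{n-s} dy`. -/
def rieszPotential {n : ℕ} (s : ℝ) (f : Euc n → ℝ) (x : Euc n) : ℝ :=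
  rieszConst n s * ∫ y : Euc n, rieszIntegrand s f x y

/-- The weak-`L^p` quasinorm `sup_{t > 0} t |{x : |g x| > t}|^{1/p}`, with values in `[0, ∞]`. -/
def weakNorm {n : ℕ} (p : ℝ) (g : Euc n → ℝ) : ENNReal :=
  ⨆ (t : ℝ) (_ : 0 < t), ENNReal.ofReal t * (volume {x : Euc n | t < |g x|}) ^ (1 / p)

/-- The volume `v_n` of the unit ball of `ℝⁿ`. -/
def unitBallVolume (n : ℕ) : ENNReal := volume (Metric.ball (0 : Euc n) 1)

/-- The function `x ↦ (a / (b + |x - x₀|²))^{(n+s)/2}`. -/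
def bubble {n : ℕ} (s a b : ℝ) (x₀ : Euc n) (x : Euc n) : ℝ :=
  (a / (b + ‖x - x₀‖ ^ 2)) ^ (((n : ℝ) + s) / 2)

end

open Filter Topology

/-! From far away, `f ≥ 0` looks like a point mass. If `M` is its mass in the ball of radius `R`
about `0`, then `I_s f ≥ γ_s M / (ρ + R)^(n-s)` a.e. on the ball of radius `ρ`. Testing the weak
norm just below this level and letting `R → ∞` with `ρ / R → ∞` gives the lower bound
(`le_weakNorm_rieszPotential`). For a bubble, inversion about `x` with squared radius `b + |x -
x₀|²` yields `I_s f(x) = γ_s ‖f‖₁ (b + |x - x₀|²)^(-(n-s)/2)` (`rieszPotential_bubble`). This is at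
most `γ_s ‖f‖₁ |x - x₀|^(-(n-s))`, whose weak norm is the claimed constant times `‖f‖₁`. -/

/-! ### Change of variables under inversion. -/

theorem ContinuousLinearMap.abs_det_reflection {E : Type*} [NormedAddCommGroup E]
    [InnerProductSpace ℝ E] (K : Submodule ℝ E) [K.HasOrthogonalProjection] :
    |(K.reflection : E →L[ℝ] E).det| = 1 := by
  have h : (K.reflection : E →L[ℝ] E).det * (K.reflection : E →L[ℝ] E).det = 1 := by
    simp only [ContinuousLinearMap.det]
    rw [← LinearMap.det_comp]
    convert LinearMap.det_id (M := E) (A := ℝ)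
    ext v
    simp
  rw [← abs_mul_abs_self] at h
  nlinarith [abs_nonneg (K.reflection : E →L[ℝ] E).det]

theorem abs_det_inversion_fderiv {n : ℕ} (c x : Euc n) (R : ℝ) :
    |((R / dist x c) ^ 2 • ((ℝ ∙ (x - c))ᗮ.reflection : Euc n →L[ℝ] Euc n)).det|
      = ((R / dist x c) ^ 2) ^ n := by
  have h := ContinuousLinearMap.abs_det_reflection (ℝ ∙ (x - c))ᗮ
  simp only [ContinuousLinearMap.det] at h ⊢
  rw [ContinuousLinearMap.toLinearMap_smul, LinearMap.det_smul, abs_mul, h, mul_one,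
    finrank_euclideanSpace_fin, abs_of_nonneg (by positivity)]

theorem EuclideanGeometry.image_inversion_compl_center {n : ℕ} (c : Euc n) {R : ℝ} (hR : R ≠ 0) :
    inversion c R '' {c}ᶜ = {c}ᶜ := by
  rw [Set.image_compl_eq (inversion_bijective c hR), Set.image_singleton, inversion_self]

theorem integral_comp_inversion {n : ℕ} [NeZero n] (c : Euc n) {R : ℝ} (hR : R ≠ 0)
    (g : Euc n → ℝ) :
    ∫ z, g z = ∫ z, ((R / dist z c) ^ 2) ^ n * g (EuclideanGeometry.inversion c R z) := by
  have key := integral_image_eq_integral_abs_det_fderiv_smul (volume : Measure (Euc n))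
    (s := {c}ᶜ) (measurableSet_singleton c).compl
    (fun z hz => (EuclideanGeometry.hasFDerivAt_inversion (R := R) hz).hasFDerivWithinAt)
    (EuclideanGeometry.inversion_injective c hR).injOn g
  rw [EuclideanGeometry.image_inversion_compl_center c hR] at key
  simp only [restrict_compl_singleton, smul_eq_mul] at key
  rw [key]
  exact integral_congr_ae (.of_forall fun z => by simp only [abs_det_inversion_fderiv])

/-! ### Bubbles and their Riesz potentials. -/

/-- With `w = z - x`, both sides expand to `R² + 2 (R²/|w|²) ⟪x - x₀, w⟫ + R⁴/|w|²`; the choice of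
`R` makes the constant terms agree. -/
theorem add_norm_inversion_sub_sq {n : ℕ} (x x₀ z : Euc n) (hz : z ≠ x) {b R : ℝ}
    (hR : R ^ 2 = b + ‖x - x₀‖ ^ 2) :
    b + ‖EuclideanGeometry.inversion x R z - x₀‖ ^ 2
      = R ^ 2 / ‖z - x‖ ^ 2 * (b + ‖z - x₀‖ ^ 2) := by
  have hu : ‖z - x‖ ≠ 0 := norm_ne_zero_iff.2 (sub_ne_zero.2 hz)
  have e1 : EuclideanGeometry.inversion x R z - x₀
      = (x - x₀) + (R ^ 2 / ‖z - x‖ ^ 2) • (z - x) := by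
    simp only [EuclideanGeometry.inversion, dist_eq_norm, vsub_eq_sub, vadd_eq_add, div_pow]
    abel
  have e2 : z - x₀ = (x - x₀) + (z - x) := by abel
  rw [e1, e2, norm_add_sq_real, norm_add_sq_real, norm_smul, real_inner_smul_right, mul_pow,
    Real.norm_eq_abs, sq_abs]
  have : b = R ^ 2 - ‖x - x₀‖ ^ 2 := by linarith
  subst this
  field_simp
  ring

theorem bubble_inversion {n : ℕ} {s a b : ℝ} (ha : 0 < a) (hb : 0 < b) (x x₀ z : Euc n)
    (hz : z ≠ x) :
    ((√(b + ‖x - x₀‖ ^ 2) / dist z x) ^ 2) ^ n *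
        bubble s a b x₀ (EuclideanGeometry.inversion x √(b + ‖x - x₀‖ ^ 2) z)
      = (b + ‖x - x₀‖ ^ 2) ^ (((n : ℝ) - s) / 2) *
        (bubble s a b x₀ z / ‖x - z‖ ^ ((n : ℝ) - s)) := by
  have hq : 0 < b + ‖x - x₀‖ ^ 2 := by positivity
  have hQ : 0 < b + ‖z - x₀‖ ^ 2 := by positivity
  have hu : 0 < ‖z - x‖ := norm_pos_iff.2 (sub_ne_zero.2 hz)
  have hR := Real.sq_sqrt hq.le
  unfold bubble
  rw [add_norm_inversion_sub_sq x x₀ z hz hR, div_pow, hR, dist_eq_norm, norm_sub_rev x z]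
  generalize b + ‖x - x₀‖ ^ 2 = q at *
  generalize b + ‖z - x₀‖ ^ 2 = Q at *
  generalize ‖z - x‖ = u at *
  have h1 : a / (q / u ^ 2 * Q) = a / Q / (q / u ^ 2) := by field_simp
  rw [h1, Real.div_rpow (by positivity) (by positivity) (_ : ℝ), ← Real.rpow_natCast (q / u ^ 2)]
  have h2 : u ^ ((n : ℝ) - s) = (u ^ 2) ^ (((n : ℝ) - s) / 2) := by
    rw [← Real.rpow_natCast u 2, ← Real.rpow_mul hu.le]
    congr 1
    push_cast
    ring
  -- One factor of the Jacobian becomes the Riesz kernel; the other cancels the conformal factor of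
  -- the bubble.
  have h3 : (q / u ^ 2) ^ (n : ℝ)
      = (q / u ^ 2) ^ (((n : ℝ) - s) / 2) * (q / u ^ 2) ^ (((n : ℝ) + s) / 2) := by
    rw [← Real.rpow_add (by positivity)]
    congr 1
    ring
  rw [h2, h3, Real.div_rpow hq.le (by positivity) (((n : ℝ) - s) / 2)]
  have h4 : (q / u ^ 2) ^ (((n : ℝ) + s) / 2) ≠ 0 := by positivity
  field_simp

theorem integral_rieszIntegrand {n : ℕ} (s : ℝ) (f : Euc n → ℝ) (x : Euc n) :
    ∫ y, rieszIntegrand s f x y = ∫ z, f z / ‖x - z‖ ^ ((n : ℝ) - s) := by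
  rw [← integral_sub_left_eq_self _ volume x]
  simp [rieszIntegrand]

theorem rieszPotential_bubble {n : ℕ} [NeZero n] {s a b : ℝ} (ha : 0 < a) (hb : 0 < b)
    (x₀ x : Euc n) :
    rieszPotential s (bubble s a b x₀) x =
      rieszConst n s * (∫ z, bubble s a b x₀ z) /
        (b + ‖x - x₀‖ ^ 2) ^ (((n : ℝ) - s) / 2) := by
  have hq : 0 < b + ‖x - x₀‖ ^ 2 := by positivity
  have hne : ∀ᵐ z : Euc n, z ≠ x := by simp [ae_iff]
  have h : ∫ z, bubble s a b x₀ z = (b + ‖x - x₀‖ ^ 2) ^ (((n : ℝ) - s) / 2) *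
      ∫ z, bubble s a b x₀ z / ‖x - z‖ ^ ((n : ℝ) - s) := by
    rw [integral_comp_inversion x (Real.sqrt_ne_zero'.2 hq), ← integral_const_mul]
    exact integral_congr_ae (hne.mono fun z hz => bubble_inversion ha hb x x₀ z hz)
  have : (b + ‖x - x₀‖ ^ 2) ^ (((n : ℝ) - s) / 2) ≠ 0 := by positivity
  rw [rieszPotential, integral_rieszIntegrand, h]
  field_simp

theorem bubble_nonneg {n : ℕ} {s a b : ℝ} (ha : 0 < a) (hb : 0 < b) (x₀ x : Euc n) :
    0 ≤ bubble s a b x₀ x := by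
  unfold bubble
  positivity

theorem memLp_bubble {n : ℕ} {s a b : ℝ} (hs : 0 < s) (ha : 0 < a) (hb : 0 < b) (x₀ : Euc n) :
    MemLp (bubble s a b x₀) 1 volume := by
  rw [memLp_one_iff_integrable]
  have hr : (Module.finrank ℝ (Euc n) : ℝ) < n + s := by simpa using hs
  have h := (((integrable_rpow_neg_one_add_norm_sq (μ := (volume : Measure (Euc n))) hr).comp_smul
    (R := (√b)⁻¹) (by positivity)).const_mul ((a / b) ^ (((n : ℝ) + s) / 2))).comp_sub_right x₀
  refine h.congr (.of_forall fun x => ?_)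
  have e : a / (b + ‖x - x₀‖ ^ 2) = a / b * (1 + ‖(√b)⁻¹ • (x - x₀)‖ ^ 2)⁻¹ := by
    rw [norm_smul, mul_pow, Real.norm_eq_abs, sq_abs, inv_pow, Real.sq_sqrt hb.le]
    field_simp
  simp only [bubble]
  rw [e, Real.mul_rpow (by positivity) (by positivity), Real.inv_rpow (by positivity), neg_div,
    Real.rpow_neg (by positivity)]

theorem rieszConst_pos {n : ℕ} {s : ℝ} (hs : 0 < s) (hsn : s < n) : 0 < rieszConst n s := by
  have := Real.Gamma_pos_of_pos (half_pos hs)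
  have := Real.Gamma_pos_of_pos (half_pos (sub_pos.2 hsn))
  have := Real.pi_pos
  unfold rieszConst
  positivity

/-! ### Weak norm under power decay. -/

theorem volume_ball_rpow {n : ℕ} {s : ℝ} (hs : 0 < s) (hsn : s < n) (x : Euc n) {r : ℝ}
    (hr : 0 ≤ r) :
    volume (Metric.ball x r) ^ (((n : ℝ) - s) / n)
      = ENNReal.ofReal (r ^ ((n : ℝ) - s)) * unitBallVolume n ^ (((n : ℝ) - s) / n) := by
  have hn : (0 : ℝ) < n := hs.trans hsn
  have : NeZero n := ⟨by rintro rfl; simp at hn⟩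
  have hp : 0 ≤ ((n : ℝ) - s) / n := div_nonneg (sub_nonneg.2 hsn.le) hn.le
  rw [Measure.addHaar_ball _ _ hr, ENNReal.mul_rpow_of_nonneg _ _ hp,
    finrank_euclideanSpace_fin, ENNReal.ofReal_rpow_of_nonneg (by positivity) hp,
    ← Real.rpow_natCast r n, ← Real.rpow_mul hr, mul_div_cancel₀ _ hn.ne', unitBallVolume]

theorem weakNorm_le_of_abs_mul_rpow_le {n : ℕ} {s A : ℝ} (hs : 0 < s) (hsn : s < n)
    (hA : 0 ≤ A) (g : Euc n → ℝ) (x₀ : Euc n)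
    (hg : ∀ x, |g x| * ‖x - x₀‖ ^ ((n : ℝ) - s) ≤ A) :
    weakNorm ((n : ℝ) / ((n : ℝ) - s)) g
      ≤ ENNReal.ofReal A * unitBallVolume n ^ (((n : ℝ) - s) / n) := by
  have hd : 0 < (n : ℝ) - s := sub_pos.2 hsn
  have hn : (0 : ℝ) < n := hs.trans hsn
  have : NeZero n := ⟨by rintro rfl; simp at hn⟩
  refine iSup₂_le fun t ht => ?_
  rw [one_div_div]
  set ρ := (A / t) ^ ((n : ℝ) - s)⁻¹
  have hρ0 : 0 ≤ ρ := by positivity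
  have hρp : ρ ^ ((n : ℝ) - s) = A / t := Real.rpow_inv_rpow (by positivity) hd.ne'
  have hsub : {x : Euc n | t < |g x|} ⊆ Metric.closedBall x₀ ρ := by
    intro x (hx : t < |g x|)
    rw [mem_closedBall_iff_norm]
    refine (Real.rpow_le_rpow_iff (norm_nonneg _) hρ0 hd).1 ?_
    rw [hρp, le_div_iff₀ ht]
    have : 0 ≤ ‖x - x₀‖ ^ ((n : ℝ) - s) := by positivity
    nlinarith [hg x]
  calc ENNReal.ofReal t * volume {x : Euc n | t < |g x|} ^ (((n : ℝ) - s) / n)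
      ≤ ENNReal.ofReal t * volume (Metric.ball x₀ ρ) ^ (((n : ℝ) - s) / n) := by
        rw [← Measure.addHaar_closedBall_eq_addHaar_ball]
        gcongr
    _ = _ := by
      rw [volume_ball_rpow hs hsn x₀ hρ0, hρp, ← mul_assoc, ← ENNReal.ofReal_mul ht.le,
        mul_div_cancel₀ _ ht.ne']

/-! ### Convergence and the lower bound. -/

theorem rieszKernel_measurable (n : ℕ) (s : ℝ) :
    Measurable fun y : Euc n => (‖y‖ ^ ((n : ℝ) - s))⁻¹ := by fun_prop

theorem integrableOn_ball_rieszKernel {n : ℕ} {s : ℝ} (hs : 0 < s) (hsn : s < n) :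
    IntegrableOn (fun y : Euc n => (‖y‖ ^ ((n : ℝ) - s))⁻¹) (Metric.ball 0 1) := by
  have hn : 1 ≤ n := by
    rw [Nat.one_le_iff_ne_zero]
    rintro rfl
    simp at hsn
    linarith
  refine integrableOn_ball_of_norm_le_rpow (by simpa using hn) (C := 1) (α := (n : ℝ) - s)
    (by simpa using hs) (.of_forall fun y => ?_) (rieszKernel_measurable n s).aestronglyMeasurable
  rw [Real.norm_of_nonneg (by positivity), Real.rpow_neg (norm_nonneg _), one_mul]

/-- The kernel splits at the unit sphere into an `L¹` part, whose convolution with `f` exists a.e.,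
and a part bounded by `1`. -/
theorem ae_integrable_rieszIntegrand {n : ℕ} {s : ℝ} (hs : 0 < s) (hsn : s < n) {f : Euc n → ℝ}
    (hf : Integrable f) : ∀ᵐ x, Integrable (rieszIntegrand s f x) := by
  have hK := (integrable_indicator_iff Metric.isOpen_ball.measurableSet).2
    (integrableOn_ball_rieszKernel hs hsn)
  filter_upwards [hK.ae_convolution_exists (ContinuousLinearMap.mul ℝ ℝ) hf] with x hx
  have hfar : Integrable fun y : Euc n =>
      ((Metric.ball 0 1)ᶜ.indicator fun y : Euc n => (‖y‖ ^ ((n : ℝ) - s))⁻¹) y * f (x - y) := by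
    refine (hf.comp_sub_left x).bdd_mul (c := 1)
      ((rieszKernel_measurable n s).indicator
        Metric.isOpen_ball.measurableSet.compl).aestronglyMeasurable (.of_forall fun y => ?_)
    by_cases hy : y ∈ (Metric.ball (0 : Euc n) 1)ᶜ
    · rw [Set.indicator_of_mem hy, Real.norm_of_nonneg (by positivity)]
      have hy' : 1 ≤ ‖y‖ := by simpa using hy
      exact inv_le_one_of_one_le₀ (Real.one_le_rpow hy' (sub_pos.2 hsn).le)
    · simp [Set.indicator_of_notMem hy]
  refine (Integrable.add hx hfar).congr (.of_forall fun y => ?_)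
  simp only [Pi.add_apply, ContinuousLinearMap.mul_apply', rieszIntegrand]
  rw [← add_mul, Set.indicator_self_add_compl_apply, div_eq_mul_inv, mul_comm]

theorem setIntegral_ball_div_le_integral_rieszIntegrand {n : ℕ} [NeZero n] {s : ℝ}
    (hsn : s < n) {f : Euc n → ℝ} (hf : Integrable f) (hf0 : ∀ᵐ x, 0 ≤ f x) {x : Euc n}
    (hx : Integrable (rieszIntegrand s f x)) {ρ R : ℝ} (hxρ : ‖x‖ < ρ) :
    (∫ z in Metric.ball 0 R, f z) / (ρ + R) ^ ((n : ℝ) - s) ≤ ∫ y, rieszIntegrand s f x y := by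
  have hint : Integrable fun z => f z / ‖x - z‖ ^ ((n : ℝ) - s) := by
    simpa [rieszIntegrand] using hx.comp_sub_left x
  have hne : ∀ᵐ z : Euc n, z ≠ x := by simp [ae_iff]
  rw [integral_rieszIntegrand, ← integral_div]
  refine (setIntegral_mono_on_ae (hf.div_const _).integrableOn hint.integrableOn
    Metric.isOpen_ball.measurableSet ?_).trans (setIntegral_le_integral hint ?_)
  · filter_upwards [hf0, hne] with z hz hzx hzR
    have hpos : 0 < ‖x - z‖ := norm_pos_iff.2 (sub_ne_zero.2 hzx.symm)
    have hle : ‖x - z‖ ≤ ρ + R := by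
      have := norm_sub_le x z
      have : ‖z‖ < R := by simpa using hzR
      linarith
    have := Real.rpow_le_rpow hpos.le hle (sub_pos.2 hsn).le
    gcongr
  · filter_upwards [hf0] with z hz
    simp only [Pi.zero_apply]
    positivity

theorem le_weakNorm_rieszPotential_of_radius {n : ℕ} [NeZero n] {s : ℝ} (hs : 0 < s)
    (hsn : s < n) {f : Euc n → ℝ} (hf : Integrable f) (hf0 : ∀ᵐ x, 0 ≤ f x) {ρ R : ℝ}
    (hρ : 0 < ρ) (hR : 0 ≤ R) :
    ENNReal.ofReal (rieszConst n s * (∫ z in Metric.ball 0 R, f z) *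
        (ρ / (ρ + R + 1)) ^ ((n : ℝ) - s)) * unitBallVolume n ^ (((n : ℝ) - s) / n)
      ≤ weakNorm ((n : ℝ) / ((n : ℝ) - s)) (rieszPotential s f) := by
  have hd : 0 < (n : ℝ) - s := sub_pos.2 hsn
  have hγ := rieszConst_pos hs hsn
  have hM : 0 ≤ ∫ z in Metric.ball 0 R, f z := integral_nonneg_of_ae (ae_restrict_of_ae hf0)
  set M := ∫ z in Metric.ball 0 R, f z
  rcases hM.eq_or_lt with hM | hM
  · simp [← hM]
  -- The `+ 1` puts `t` strictly below the pointwise bound, since superlevel sets are strict.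
  set t := rieszConst n s * M / (ρ + R + 1) ^ ((n : ℝ) - s) with ht
  have ht0 : 0 < t := by positivity
  have hsub : Metric.ball (0 : Euc n) ρ ≤ᵐ[volume] {x | t < |rieszPotential s f x|} := by
    filter_upwards [ae_integrable_rieszIntegrand hs hsn hf] with x hx (hxρ : x ∈ Metric.ball 0 ρ)
    have h := setIntegral_ball_div_le_integral_rieszIntegrand hsn hf hf0 hx (R := R)
      (mem_ball_zero_iff.1 hxρ)
    refine lt_of_lt_of_le ?_ (le_abs_self _)
    calc t = rieszConst n s * (M / (ρ + R + 1) ^ ((n : ℝ) - s)) := by rw [ht, mul_div_assoc]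
      _ < rieszConst n s * (M / (ρ + R) ^ ((n : ℝ) - s)) := by
        have := Real.rpow_lt_rpow (by positivity : 0 ≤ ρ + R) (lt_add_one (ρ + R)) hd
        have : 0 < (ρ + R) ^ ((n : ℝ) - s) := by positivity
        gcongr
      _ ≤ rieszPotential s f x := by
        unfold rieszPotential
        gcongr
  have e : rieszConst n s * M * (ρ / (ρ + R + 1)) ^ ((n : ℝ) - s) = t * ρ ^ ((n : ℝ) - s) := by
    rw [ht, Real.div_rpow hρ.le (by positivity)]
    field_simp
  rw [e, ENNReal.ofReal_mul ht0.le, mul_assoc, ← volume_ball_rpow hs hsn 0 hρ.le]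
  refine le_trans ?_ (le_iSup₂ (f := fun (t : ℝ) (_ : 0 < t) => ENNReal.ofReal t *
    volume {x : Euc n | t < |rieszPotential s f x|} ^ (1 / ((n : ℝ) / ((n : ℝ) - s)))) t ht0)
  rw [one_div_div]
  have := measure_mono_ae hsub
  gcongr

theorem tendsto_sq_div_sq_add_add_one :
    Tendsto (fun k : ℝ => k ^ 2 / (k ^ 2 + k + 1)) atTop (𝓝 1) := by
  have h1 : Tendsto (fun k : ℝ => 1 + k⁻¹ + k⁻¹ ^ 2) atTop (𝓝 1) := by
    simpa using (tendsto_inv_atTop_zero.const_add (1 : ℝ)).add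
      ((tendsto_inv_atTop_zero (𝕜 := ℝ)).pow 2)
  have h2 := h1.inv₀ one_ne_zero
  rw [inv_one] at h2
  refine h2.congr' ?_
  filter_upwards [eventually_gt_atTop 0] with k hk
  field_simp

theorem le_weakNorm_rieszPotential {n : ℕ} [NeZero n] {s : ℝ} (hs : 0 < s) (hsn : s < n)
    {f : Euc n → ℝ} (hf : Integrable f) (hf0 : ∀ᵐ x, 0 ≤ f x) :
    ENNReal.ofReal (rieszConst n s * ∫ z, f z) * unitBallVolume n ^ (((n : ℝ) - s) / n)
      ≤ weakNorm ((n : ℝ) / ((n : ℝ) - s)) (rieszPotential s f) := by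
  have hd : 0 < (n : ℝ) - s := sub_pos.2 hsn
  have hv : unitBallVolume n ^ (((n : ℝ) - s) / n) ≠ ⊤ :=
    ENNReal.rpow_ne_top_of_nonneg (div_nonneg hd.le n.cast_nonneg) measure_ball_lt_top.ne
  have hM : Tendsto (fun k : ℝ => ∫ z in Metric.ball 0 k, f z) atTop (𝓝 (∫ z, f z)) :=
    (aecover_ball tendsto_id).integral_tendsto_of_countably_generated hf
  have hq := tendsto_sq_div_sq_add_add_one.rpow_const (p := (n : ℝ) - s) (.inl one_ne_zero)
  have hlim := ENNReal.Tendsto.mul_const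
    (ENNReal.tendsto_ofReal ((hM.const_mul (rieszConst n s)).mul hq)) (.inr hv)
  rw [Real.one_rpow, mul_one] at hlim
  refine le_of_tendsto hlim ?_
  filter_upwards [eventually_gt_atTop 0] with k hk
  -- Here `R = k` and `ρ = k²`, so that `ρ / (ρ + R + 1) → 1`.
  exact le_weakNorm_rieszPotential_of_radius hs hsn hf hf0 (by positivity) hk.le

theorem ofReal_mul_integral_mul {n : ℕ} {f : Euc n → ℝ} (hf : Integrable f)
    (hf0 : ∀ᵐ x, 0 ≤ f x) {c : ℝ} (hc : 0 ≤ c) (v : ENNReal) :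
    ENNReal.ofReal (c * ∫ z, f z) * v = ENNReal.ofReal c * v * eLpNorm f 1 volume := by
  rw [ENNReal.ofReal_mul hc, ofReal_integral_eq_lintegral_ofReal hf hf0,
    eLpNorm_one_eq_lintegral_enorm, mul_right_comm]
  congr 1
  refine lintegral_congr_ae ?_
  filter_upwards [hf0] with x hx
  exact (Real.enorm_of_nonneg hx).symm

theorem weakNorm_rieszPotential_bubble_le {n : ℕ} [NeZero n] {s a b : ℝ} (hs : 0 < s)
    (hsn : s < n) (ha : 0 < a) (hb : 0 < b) (x₀ : Euc n) :
    weakNorm ((n : ℝ) / ((n : ℝ) - s)) (rieszPotential s (bubble s a b x₀)) ≤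
      ENNReal.ofReal (rieszConst n s * ∫ z, bubble s a b x₀ z) *
        unitBallVolume n ^ (((n : ℝ) - s) / n) := by
  have hd : 0 < (n : ℝ) - s := sub_pos.2 hsn
  have hA : 0 ≤ rieszConst n s * ∫ z, bubble s a b x₀ z :=
    mul_nonneg (rieszConst_pos hs hsn).le (integral_nonneg fun z => bubble_nonneg ha hb x₀ z)
  refine weakNorm_le_of_abs_mul_rpow_le hs hsn hA _ x₀ fun x => ?_
  have hq : 0 < b + ‖x - x₀‖ ^ 2 := by positivity
  have h : ‖x - x₀‖ ^ ((n : ℝ) - s) ≤ (b + ‖x - x₀‖ ^ 2) ^ (((n : ℝ) - s) / 2) := by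
    rw [show (n : ℝ) - s = 2 * (((n : ℝ) - s) / 2) by ring, Real.rpow_mul (norm_nonneg _),
      mul_div_cancel_left₀ _ two_ne_zero, Real.rpow_two]
    exact Real.rpow_le_rpow (by positivity) (by linarith) (by positivity)
  rw [rieszPotential_bubble ha hb, abs_of_nonneg (by positivity), div_mul_eq_mul_div,
    div_le_iff₀ (by positivity)]
  gcongr

theorem theorem1p2 (n : ℕ) (s : ℝ) (hs : 0 < s) (hsn : s < (n : ℝ)) :
    (∀ f : Euc n → ℝ, MemLp f 1 volume → (∀ᵐ x ∂volume, 0 ≤ f x) →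
      (∀ᵐ x ∂volume, Integrable (rieszIntegrand s f x) volume) ∧
      ENNReal.ofReal (rieszConst n s) * unitBallVolume n ^ (((n : ℝ) - s) / (n : ℝ)) *
          eLpNorm f 1 volume
        ≤ weakNorm ((n : ℝ) / ((n : ℝ) - s)) (rieszPotential s f)) ∧
    (∀ (a b : ℝ) (x₀ : Euc n), 0 < a → 0 < b →
      MemLp (bubble s a b x₀) 1 volume ∧
      weakNorm ((n : ℝ) / ((n : ℝ) - s)) (rieszPotential s (bubble s a b x₀)) =
        ENNReal.ofReal (rieszConst n s) * unitBallVolume n ^ (((n : ℝ) - s) / (n : ℝ)) *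
          eLpNorm (bubble s a b x₀) 1 volume) := by
  have : NeZero n := ⟨by rintro rfl; simp at hsn; linarith⟩
  have hγ := (rieszConst_pos hs hsn).le
  refine ⟨fun f hf hf0 => ?_, fun a b x₀ ha hb => ?_⟩
  · have hf := memLp_one_iff_integrable.1 hf
    refine ⟨ae_integrable_rieszIntegrand hs hsn hf, ?_⟩
    rw [← ofReal_mul_integral_mul hf hf0 hγ]
    exact le_weakNorm_rieszPotential hs hsn hf hf0
  · have hmem := memLp_bubble (s := s) hs ha hb x₀
    have hf := memLp_one_iff_integrable.1 hmem
    have hf0 : ∀ᵐ x, 0 ≤ bubble s a b x₀ x := .of_forall (bubble_nonneg ha hb x₀)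
    refine ⟨hmem, ?_⟩
    rw [← ofReal_mul_integral_mul hf hf0 hγ]
    exact (weakNorm_rieszPotential_bubble_le hs hsn ha hb x₀).antisymm
      (le_weakNorm_rieszPotential hs hsn hf hf0)
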